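/- Let $K$ be a number field whose ring of integers is monogenic, $\mathcal{O}_K=\mathbf{Z}[\theta]$. Let $\alpha\in\mathcal{O}_K$ be such that $p=|N_{K/\mathbf{Q}}(\alpha)|$ is a prime number and such that $\alpha$ gives a canonical number system, that is, every element of $\mathcal{O}_K$ is a finite sum $\sum_{i=0}^n c_i\alpha^i$ with integers $0\le c_i\le p-1$. Let $q$ be a positive integer with $q\le|\sigma(\alpha)|$ for every embedding $\sigma:K\to\mathbf{C}$, and with $q<p$ (this last condition is automatic if $K\neq\mathbf{Q}$). Let $\psi:\mathbf{N}\to\mathbf{N}\cup\{+\infty\}$ be admissible, that is, the set $\mathbf{N}_\psi=\{n:\psi(n)\neq+\infty\}$ is either $\mathbf{N}$ or of the form $\{0,\dots,N\}$, and $\psi$ is strictly increasing on $\mathbf{N}_\psi$; let $(a_n)_{n\ge0}$ be a sequence with values in $\{1,\dots,p-1\}$. Put $$G(T)=\sum_{n=0}^{\infty}a_n\alpha^{\psi(n)}T^n\in K[[T]],\qquad \alpha^{+\infty}=0 .$$ Then the series $G(1/q)=\sum_{n\ge 0}a_n\alpha^{\psi(n)}q^{-n}$ converges in the completion $K_\alpha$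 of $K$ at the prime ideal $(\alpha)$, and $G(T)$ is a rational function (an element of $K(T)$) if and only if $G(1/q)\in K$. -/

import Mathlib

open scoped NumberField
open IsDedekindDomain

namespace CollatzCNS

/-- `ψ : ℕ → ℕ ∪ {∞}` is admissible: the set where `ψ` is finite is `{0, …, N}` for some `N`, or all
of `ℕ`, and `ψ` is strictly increasing on it. -/
def IsAdmissible (ψ : ℕ → ℕ∞) : Prop :=
  ((∃ N : ℕ, {n | ψ n ≠ ⊤} = Set.Iic N) ∨ {n | ψ n ≠ ⊤} = Set.univ) ∧
    StrictMonoOn ψ {n | ψ n ≠ ⊤}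

/-- The ring of integers is of the form `ℤ[θ]`. -/
def IsMonogenic (K : Type*) [Field K] : Prop :=
  ∃ θ : 𝓞 K, Algebra.adjoin ℤ {θ} = ⊤

/-- `α` gives a canonical number system: every algebraic integer of `K` is a finite sum
`∑ cᵢ αⁱ` with digits `0 ≤ cᵢ ≤ |N(α)| - 1`. -/
def IsCNS {K : Type*} [Field K] (α : 𝓞 K) : Prop :=
  ∀ x : 𝓞 K, ∃ (n : ℕ) (c : ℕ → ℕ), (∀ i, c i < (Algebra.norm ℤ α).natAbs) ∧
    x = ∑ i ∈ Finset.range (n + 1), (c i : 𝓞 K) * α ^ i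

/-- The finite place of `K` given by the ideal `(α)`, which is prime because its norm is. -/
def place {K : Type*} [Field K] [NumberField K] (α : 𝓞 K)
    (hα : (Algebra.norm ℤ α).natAbs.Prime) : HeightOneSpectrum (𝓞 K) where
  asIdeal := Ideal.span {α}
  isPrime := Ideal.isPrime_of_irreducible_absNorm (by
    rw [Ideal.absNorm_span_singleton]
    exact hα)
  ne_bot := by
    rw [Ne, Ideal.span_singleton_eq_bot]
    rintro rfl
    rw [Algebra.norm_zero] at hα
    exact Nat.not_prime_zero hα

/-- `x ^ m` for `m ∈ ℕ ∪ {∞}`, with `x ^ ∞ = 0`. -/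
noncomputable def powENat {K : Type*} [Field K] (x : K) (m : ℕ∞) : K :=
  if m = ⊤ then 0 else x ^ m.toNat

/-- The power series `G(T) = ∑ aₙ x ^ ψ(n) Tⁿ`. -/
noncomputable def gSeries {K : Type*} [Field K] (x : K) (ψ : ℕ → ℕ∞) (a : ℕ → ℕ) :
    PowerSeries K :=
  PowerSeries.mk fun n => (a n : K) * powENat x (ψ n)

/-- A formal power series is (the expansion of) a rational function. -/
def IsRationalFunction {K : Type*} [Field K] (f : PowerSeries K) : Prop :=
  ∃ P Q : Polynomial K, Q ≠ 0 ∧ (Q : PowerSeries K) * f = (P : PowerSeries K)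

/-- The series `f(x)` converges in the `v`-adic completion `K_v` of `K`, with sum `s`. -/
def HasValueAt {K : Type*} [Field K] [NumberField K] (v : HeightOneSpectrum (𝓞 K))
    (f : PowerSeries K) (x : K) (s : v.adicCompletion K) : Prop :=
  HasSum (fun n : ℕ => algebraMap K (v.adicCompletion K) (PowerSeries.coeff n f * x ^ n)) s

end CollatzCNS

/-!
If `ψ` takes the value `+∞`, then `G` is a polynomial. Otherwise suppose that `G(1/q) = s` lies in
`K`, and let `tₙ ∈ K` be the `n`-th tail of the series divided by `α ^ ψ(n) q⁻ⁿ`. These normalized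
tails are `v`-integral, where `v` is the place `(α)`, and satisfy
`α ^ (ψ(n+1) - ψ(n)) tₙ₊₁ = q (tₙ - aₙ)`. Away from `v` the element `α` is a unit, so the
denominators of the `tₙ` are bounded. At each complex embedding `σ` the recursion is a contraction
by `q / |σ(α)| < 1`, so the `tₙ` are bounded there as well; equality `q = |σ(α)|` is impossible,
since then `q² / α` would be an algebraic integer and `q` would lie in the prime ideal `(α)`. Hence
the `tₙ` take finitely many values. As `tₙ ≡ aₙ` modulo `(α)` and `tₙ` is a `v`-adic unit, the value
of `tₙ` determines the digit `aₙ`, the gap `ψ(n+1) - ψ(n)` and the value of `tₙ₊₁`, so digits and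
gaps are eventually periodic and `G` is rational. Conversely, if `Q G = P` with `P`, `Q` coprime,
evaluating at `1/q` shows `Q(1/q) ≠ 0` and `s = P(1/q) / Q(1/q)`.
-/

namespace CollatzCNS

section RationalFunction

variable {K : Type*} [Field K] {f : PowerSeries K}

theorem isRationalFunction_of_coeff_mul_eq_zero {Q : Polynomial K} (hQ : Q ≠ 0) {N : ℕ}
    (h : ∀ n, N ≤ n → PowerSeries.coeff n ((Q : PowerSeries K) * f) = 0) :
    IsRationalFunction f := by
  refine ⟨PowerSeries.trunc N ((Q : PowerSeries K) * f), Q, hQ, ?_⟩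
  ext n
  rw [Polynomial.coeff_coe, PowerSeries.coeff_trunc]
  split_ifs with hn
  · rfl
  · exact h n (not_lt.mp hn)

theorem isRationalFunction_of_coeff_add_eq_mul {m n : ℕ} (hmn : m ≠ n) (c : K)
    (h : ∀ k, PowerSeries.coeff (n + k) f = c * PowerSeries.coeff (m + k) f) :
    IsRationalFunction f := by
  have hQ : (Polynomial.X ^ m - Polynomial.C c * Polynomial.X ^ n : Polynomial K) ≠ 0 := by
    intro h0
    simpa [Polynomial.coeff_X_pow, hmn] using congrArg (Polynomial.coeff · m) h0
  refine isRationalFunction_of_coeff_mul_eq_zero hQ (N := m + n) fun k hk => ?_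
  obtain ⟨j, rfl⟩ := Nat.exists_eq_add_of_le' hk
  have hm : PowerSeries.coeff (j + (m + n)) (PowerSeries.X ^ m * f) =
      PowerSeries.coeff (n + j) f := by
    rw [show j + (m + n) = n + j + m by ring, PowerSeries.coeff_X_pow_mul]
  have hn : PowerSeries.coeff (j + (m + n)) (PowerSeries.X ^ n * f) =
      PowerSeries.coeff (m + j) f := by
    rw [show j + (m + n) = m + j + n by ring, PowerSeries.coeff_X_pow_mul]
  simp [sub_mul, mul_assoc, hm, hn, h j]

theorem IsRationalFunction.exists_isCoprime (hf : IsRationalFunction f) :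
    ∃ P Q : Polynomial K, IsCoprime P Q ∧ (Q : PowerSeries K) * f = (P : PowerSeries K) := by
  obtain ⟨P, Q, hQ, hPQ⟩ := hf
  obtain ⟨P', Q', D, hrel, rfl, rfl⟩ :=
    UniqueFactorizationMonoid.exists_reduced_factors' P Q hQ
  refine ⟨P', Q', hrel.isCoprime, ?_⟩
  have hD : (D : PowerSeries K) ≠ 0 :=
    fun h0 => left_ne_zero_of_mul hQ (Polynomial.coe_eq_zero_iff.mp h0)
  rw [Polynomial.coe_mul, Polynomial.coe_mul, mul_assoc] at hPQ
  exact mul_left_cancel₀ hD hPQ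

variable {A : Type*} [Ring A] [Algebra K A] [TopologicalSpace A] [IsTopologicalRing A]
  {x : K} {s : A}

theorem hasSum_coeff_X_mul
    (h : HasSum (fun n => algebraMap K A (PowerSeries.coeff n f * x ^ n)) s) :
    HasSum (fun n => algebraMap K A (PowerSeries.coeff n (PowerSeries.X * f) * x ^ n))
      (algebraMap K A x * s) := by
  rw [← hasSum_nat_add_iff' 1]
  convert! h.mul_left (algebraMap K A x) using 1
  · ext1 n
    rw [PowerSeries.coeff_succ_X_mul, ← map_mul]
    congr 1
    ring
  · simp

theorem hasSum_coeff_polynomial_mul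
    (h : HasSum (fun n => algebraMap K A (PowerSeries.coeff n f * x ^ n)) s)
    (Q : Polynomial K) :
    HasSum (fun n => algebraMap K A (PowerSeries.coeff n ((Q : PowerSeries K) * f) * x ^ n))
      (algebraMap K A (Q.eval x) * s) := by
  induction Q using Polynomial.induction_on with
  | C c => simpa [mul_assoc] using h.mul_left (algebraMap K A c)
  | add P Q hP hQ => simpa [add_mul] using hP.add hQ
  | monomial n c ih =>
    convert! hasSum_coeff_X_mul ih using 1
    · simp only [Polynomial.coe_mul, Polynomial.coe_pow, Polynomial.coe_X, pow_succ,
        mul_assoc, mul_left_comm PowerSeries.X]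
    · rw [← mul_assoc, ← map_mul]
      simp only [Polynomial.eval_mul, Polynomial.eval_C, Polynomial.eval_pow, Polynomial.eval_X,
        pow_succ']
      ring_nf

theorem hasSum_coeff_polynomial (P : Polynomial K) :
    HasSum (fun n => algebraMap K A (PowerSeries.coeff n (P : PowerSeries K) * x ^ n))
      (algebraMap K A (P.eval x)) := by
  have h1 : HasSum (fun n => algebraMap K A (PowerSeries.coeff n (1 : PowerSeries K) * x ^ n))
      1 := by
    convert! hasSum_ite_eq 0 (1 : A) using 2 with n
    split_ifs with hn <;> simp [PowerSeries.coeff_one, hn]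
  simpa using hasSum_coeff_polynomial_mul h1 P

theorem IsRationalFunction.mem_range_of_hasSum [T2Space A] [Nontrivial A]
    (hf : IsRationalFunction f)
    (hs : HasSum (fun n => algebraMap K A (PowerSeries.coeff n f * x ^ n)) s) :
    s ∈ Set.range (algebraMap K A) := by
  obtain ⟨P, Q, hcop, hPQ⟩ := hf.exists_isCoprime
  have hval : algebraMap K A (Q.eval x) * s = algebraMap K A (P.eval x) := by
    have h := hasSum_coeff_polynomial_mul hs Q
    rw [hPQ] at h
    exact h.unique (hasSum_coeff_polynomial P)
  have hQx : Q.eval x ≠ 0 := by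
    intro hQ0
    have hP0 : P.eval x = 0 := by
      rwa [hQ0, map_zero, zero_mul, eq_comm, map_eq_zero] at hval
    obtain ⟨U, V, hUV⟩ := hcop
    simpa [hP0, hQ0] using congrArg (Polynomial.eval x) hUV
  refine ⟨(Q.eval x)⁻¹ * P.eval x, ?_⟩
  rw [map_mul, ← hval, ← mul_assoc, ← map_mul, inv_mul_cancel₀ hQx, map_one, one_mul]

end RationalFunction

section Valued

variable {A Γ₀ : Type*} [Ring A] [LinearOrderedCommGroupWithZero Γ₀] [Valued A Γ₀]

theorem nonarchimedeanAddGroup_of_valued : NonarchimedeanAddGroup A where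
  is_nonarchimedean U hU := by
    obtain ⟨γ, hγ⟩ := Valued.mem_nhds_zero.mp hU
    exact ⟨⟨Valuation.ltAddSubgroup Valued.v.restrict γ, Valued.isOpen_ball A γ.1⟩, hγ⟩

theorem summable_of_valued_le [CompleteSpace A] {ι : Type*} {f g : ι → A}
    (hg : Filter.Tendsto g Filter.cofinite (nhds 0))
    (hfg : ∀ i, Valued.v (f i) ≤ Valued.v (g i)) : Summable f := by
  have := nonarchimedeanAddGroup_of_valued (A := A)
  apply NonarchimedeanAddGroup.summable_of_tendsto_cofinite_zero
  rw [(Valued.hasBasis_nhds_zero _ _).tendsto_right_iff] at hg ⊢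
  intro γ hγ
  filter_upwards [hg γ hγ] with i hi
  exact lt_of_le_of_lt (by rw [Valuation.restrict_le_iff]; exact hfg i) hi

theorem valued_le_one_of_hasSum {ι : Type*} {f : ι → A} {s : A} (hs : HasSum f s)
    (hf : ∀ i, Valued.v (f i) ≤ 1) : Valued.v s ≤ 1 :=
  (Valued.isClosed_integer A).mem_of_tendsto hs
    (Filter.Eventually.of_forall fun _ => Subring.sum_mem _ fun i _ => hf i)

end Valued

/-- The sequence `t` obeys the recursion `π ^ eₙ tₙ₊₁ = q (tₙ - aₙ)` with `eₙ ≠ 0`. The tails of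
`∑ aₙ π ^ φ(n) q⁻ⁿ`, divided by `π ^ φ(n) q⁻ⁿ`, do so with `eₙ = φ(n + 1) - φ(n)`. -/
structure IsDigitOrbit {F : Type*} [Field F] (π q : F) (a : ℕ → F) (e : ℕ → ℕ) (t : ℕ → F) :
    Prop where
  exponent_ne_zero : ∀ n, e n ≠ 0
  step : ∀ n, π ^ e n * t (n + 1) = q * (t n - a n)

namespace IsDigitOrbit

theorem map {E F : Type*} [Field E] [Field F] {π q : F} {a : ℕ → F} {e : ℕ → ℕ} {t : ℕ → F}
    (h : IsDigitOrbit π q a e t) (σ : F →+* E) : IsDigitOrbit (σ π) (σ q) (σ ∘ a) e (σ ∘ t) where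
  exponent_ne_zero := h.exponent_ne_zero
  step n := by simpa using congrArg σ (h.step n)

variable {F Γ₀ : Type*} [Field F] [LinearOrderedCommGroupWithZero Γ₀] {v : Valuation F Γ₀}
  {π q : F} {a : ℕ → F} {e : ℕ → ℕ} {t : ℕ → F}

theorem valuation_sub_digit_lt_one (h : IsDigitOrbit π q a e t) (hπ : v π < 1) (hq : v q = 1)
    (ht : ∀ n, v (t n) ≤ 1) (n : ℕ) : v (t n - a n) < 1 := by
  have hstep : v π ^ e n * v (t (n + 1)) = v (t n - a n) := by
    simpa [hq] using congrArg v (h.step n)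
  rw [← hstep]
  exact mul_lt_one_of_lt_of_le (pow_lt_one₀ zero_le hπ (h.exponent_ne_zero n)) (ht _)

theorem valuation_eq_one (h : IsDigitOrbit π q a e t) (hπ : v π < 1) (hq : v q = 1)
    (ha : ∀ n, v (a n) = 1) (ht : ∀ n, v (t n) ≤ 1) (n : ℕ) : v (t n) = 1 := by
  have hlt := h.valuation_sub_digit_lt_one hπ hq ht n
  rw [← ha n] at hlt
  exact (Valuation.map_eq_of_sub_lt v hlt).trans (ha n)

theorem digit_eq (h : IsDigitOrbit π q a e t) (hπ : v π < 1) (hq : v q = 1)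
    (ht : ∀ n, v (t n) ≤ 1) (hinj : ∀ m n, v (a m - a n) < 1 → a m = a n) {m n : ℕ}
    (hmn : t m = t n) : a m = a n := by
  apply hinj
  have hm := h.valuation_sub_digit_lt_one hπ hq ht m
  have hn := h.valuation_sub_digit_lt_one hπ hq ht n
  rw [show a m - a n = (t n - a n) - (t m - a m) by rw [hmn]; ring]
  exact v.map_sub_lt hn hm

theorem exponent_eq (h : IsDigitOrbit π q a e t) (hπ0 : π ≠ 0) (hπ : v π < 1) (hq : v q = 1)
    (ha : ∀ n, v (a n) = 1) (ht : ∀ n, v (t n) ≤ 1)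
    {m n : ℕ} (hmn : t m = t n) (hdigit : a m = a n) : e m = e n := by
  have hstep : π ^ e m * t (m + 1) = π ^ e n * t (n + 1) := by
    rw [h.step, h.step, hmn, hdigit]
  have hval : v π ^ e m = v π ^ e n := by
    simpa [h.valuation_eq_one hπ hq ha ht] using congrArg v hstep
  exact pow_right_injective₀ (zero_lt_iff.mpr (v.ne_zero_iff.mpr hπ0)) hπ.ne hval

theorem add_eq (h : IsDigitOrbit π q a e t) (hπ0 : π ≠ 0) (hπ : v π < 1) (hq : v q = 1)
    (ha : ∀ n, v (a n) = 1) (ht : ∀ n, v (t n) ≤ 1)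
    (hinj : ∀ m n, v (a m - a n) < 1 → a m = a n) {m n : ℕ} (hmn : t m = t n) (k : ℕ) :
    t (m + k) = t (n + k) := by
  induction k with
  | zero => exact hmn
  | succ k ih =>
    have hdigit := h.digit_eq hπ hq ht hinj ih
    have hexp := h.exponent_eq hπ0 hπ hq ha ht ih hdigit
    refine mul_left_cancel₀ (pow_ne_zero (e (m + k)) hπ0) ?_
    calc π ^ e (m + k) * t (m + k + 1) = q * (t (m + k) - a (m + k)) := h.step _
      _ = q * (t (n + k) - a (n + k)) := by rw [ih, hdigit]
      _ = π ^ e (m + k) * t (n + k + 1) := by rw [hexp, h.step]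

end IsDigitOrbit

section Boundedness

theorem bddAbove_range_of_succ_le_mul_add {𝕜 : Type*} [Field 𝕜] [LinearOrder 𝕜]
    [IsStrictOrderedRing 𝕜] {u : ℕ → 𝕜} {r c : 𝕜} (hr0 : 0 ≤ r) (hr1 : r < 1)
    (h : ∀ n, u (n + 1) ≤ r * u n + c) : BddAbove (Set.range u) := by
  refine ⟨max (u 0) (c / (1 - r)), Set.forall_mem_range.mpr fun n => ?_⟩
  induction n with
  | zero => exact le_max_left _ _
  | succ n ih =>
    set B := max (u 0) (c / (1 - r))
    have hc : c ≤ B * (1 - r) := (div_le_iff₀ (sub_pos.mpr hr1)).mp (le_max_right _ _)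
    calc u (n + 1) ≤ r * u n + c := h n
      _ ≤ r * B + B * (1 - r) := by gcongr
      _ = B := by ring

theorem IsDigitOrbit.isBounded_range {F : Type*} [NormedField F] {π q : F} {a : ℕ → F}
    {e : ℕ → ℕ} {t : ℕ → F} (h : IsDigitOrbit π q a e t) (hπ : 1 ≤ ‖π‖) (hq : ‖q‖ < ‖π‖)
    (ha : Bornology.IsBounded (Set.range a)) : Bornology.IsBounded (Set.range t) := by
  obtain ⟨C, hC⟩ := ha.exists_norm_le
  have hπ0 : 0 < ‖π‖ := zero_lt_one.trans_le hπ
  have hstep : ∀ n, ‖t (n + 1)‖ ≤ ‖q‖ / ‖π‖ * ‖t n‖ + ‖q‖ / ‖π‖ * C := by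
    intro n
    rw [← mul_add, div_mul_eq_mul_div, le_div_iff₀ hπ0, mul_comm]
    calc ‖π‖ * ‖t (n + 1)‖ ≤ ‖π‖ ^ e n * ‖t (n + 1)‖ := by
          gcongr
          exact le_self_pow₀ hπ (h.exponent_ne_zero n)
      _ = ‖q‖ * ‖t n - a n‖ := by rw [← norm_pow, ← norm_mul, h.step, norm_mul]
      _ ≤ ‖q‖ * (‖t n‖ + C) := by
          gcongr
          exact (norm_sub_le _ _).trans (by gcongr; exact hC _ ⟨n, rfl⟩)
  obtain ⟨B, hB⟩ :=
    bddAbove_range_of_succ_le_mul_add (u := fun n => ‖t n‖) (by positivity)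
      ((div_lt_one hπ0).mpr hq) hstep
  exact isBounded_iff_forall_norm_le.mpr
    ⟨B, Set.forall_mem_range.mpr fun n => hB ⟨n, rfl⟩⟩

end Boundedness

section Dedekind

variable {R K : Type*} [CommRing R] [Field K] [Algebra R K] {v : HeightOneSpectrum R} {α : R}

theorem algebraMap_generator_ne_zero [FaithfulSMul R K] (hv : v.asIdeal = Ideal.span {α}) :
    algebraMap R K α ≠ 0 := by
  rw [Ne, FaithfulSMul.algebraMap_eq_zero_iff, ← Ideal.span_singleton_eq_bot, ← hv]
  exact v.ne_bot

variable [IsDedekindDomain R] [IsFractionRing R K]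

theorem valued_algebraMap (x : K) :
    Valued.v (algebraMap K (v.adicCompletion K) x) = v.valuation K x :=
  v.valuedAdicCompletion_eq_valuation' x

theorem valuation_natCast_le_one (n : ℕ) : v.valuation K (n : K) ≤ 1 := by
  simpa using v.valuation_le_one (K := K) (n : R)

theorem valuation_natCast_eq_one_iff {n : ℕ} :
    v.valuation K (n : K) = 1 ↔ (n : R) ∉ v.asIdeal := by
  simpa using v.valuation_eq_one_iff_notMem (K := K) (r := (n : R))

theorem valuation_generator_lt_one (hv : v.asIdeal = Ideal.span {α}) :
    v.valuation K (algebraMap R K α) < 1 :=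
  (v.valuation_lt_one_iff_mem α).mpr (hv ▸ Ideal.mem_span_singleton_self α)

theorem mem_range_of_pow_mul_mem_range (hv : v.asIdeal = Ideal.span {α}) {e : ℕ} {x : K}
    (h : algebraMap R K α ^ e * x ∈ (algebraMap R K).range) (hx : v.valuation K x ≤ 1) :
    x ∈ (algebraMap R K).range := by
  refine HeightOneSpectrum.mem_integers_of_valuation_le_one K x fun w => ?_
  by_cases hw : w = v
  · exact hw ▸ hx
  have hα : w.valuation K (algebraMap R K α) = 1 := by
    refine w.valuation_eq_one_iff_notMem.mpr fun hmem => hw ?_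
    have hle : v.asIdeal ≤ w.asIdeal := hv ▸ (Ideal.span_singleton_le_iff_mem _).mpr hmem
    exact HeightOneSpectrum.ext (v.isMaximal.eq_of_le w.isPrime.ne_top hle).symm
  obtain ⟨y, hy⟩ := h
  calc w.valuation K x = w.valuation K (algebraMap R K α ^ e * x) := by simp [hα]
    _ = w.valuation K (algebraMap R K y) := by rw [hy]
    _ ≤ 1 := w.valuation_le_one y

theorem IsDigitOrbit.exists_mul_mem_range {q : R} {a : ℕ → R} {e : ℕ → ℕ} {t : ℕ → K}
    (h : IsDigitOrbit (algebraMap R K α) (algebraMap R K q) (algebraMap R K ∘ a) e t)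
    (hv : v.asIdeal = Ideal.span {α})
    (ht : ∀ n, v.valuation K (t n) ≤ 1) :
    ∃ d : R, d ≠ 0 ∧ ∀ n, algebraMap R K d * t n ∈ (algebraMap R K).range := by
  obtain ⟨⟨x, d⟩, hxd⟩ := IsLocalization.surj (nonZeroDivisors R) (t 0)
  refine ⟨d, nonZeroDivisors.coe_ne_zero d, fun n => ?_⟩
  induction n with
  | zero => exact ⟨x, by rw [mul_comm]; exact hxd.symm⟩
  | succ n ih =>
    refine mem_range_of_pow_mul_mem_range hv (e := e n) ?_ ?_
    · rw [mul_left_comm, h.step, mul_left_comm, mul_sub]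
      exact mul_mem ⟨q, rfl⟩ (sub_mem ih (mul_mem ⟨d, rfl⟩ ⟨a n, rfl⟩))
    · rw [map_mul]
      exact mul_le_one' (v.valuation_le_one _) (ht _)

end Dedekind

section NumberField

variable {K : Type*} [Field K]

theorem dvd_natCast_of_norm_sq_embedding_eq {α : 𝓞 K} {m : ℕ} (σ : K →+* ℂ)
    (h : ‖σ (α : K)‖ ^ 2 = m) : α ∣ (m : 𝓞 K) := by
  rcases eq_or_ne α 0 with rfl | hα
  · have hm : m = 0 := by simpa using h.symm
    simp [hm]
  have hα' : (α : K) ≠ 0 := by simpa using hα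
  -- The cofactor `m / α` is integral because `σ` maps it to the complex conjugate of `σ α`.
  have hconj : σ (m / α) = (starRingEnd ℂ).comp σ α := by
    rw [map_div₀, map_natCast, div_eq_iff (by simpa using hα'), RingHom.comp_apply,
      Complex.conj_mul']
    exact_mod_cast h.symm
  have hint : IsIntegral ℤ ((m : K) / α) := by
    rw [← isIntegral_algHom_iff σ.toIntAlgHom σ.injective]
    exact hconj ▸ (NumberField.RingOfIntegers.isIntegral_coe α).map
      ((starRingEnd ℂ).comp σ).toIntAlgHom
  obtain ⟨β, hβ⟩ := (IsIntegralClosure.isIntegral_iff (A := 𝓞 K)).mp hint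
  refine ⟨β, FaithfulSMul.algebraMap_injective (𝓞 K) K ?_⟩
  rw [map_natCast, map_mul, hβ, mul_div_cancel₀ _ hα']

theorem natCast_lt_norm_embedding {v : HeightOneSpectrum (𝓞 K)} {α : 𝓞 K} {q : ℕ}
    (hv : v.asIdeal = Ideal.span {α}) (hq : (q : 𝓞 K) ∉ v.asIdeal) {σ : K →+* ℂ}
    (hqα : q ≤ ‖σ (α : K)‖) : q < ‖σ (α : K)‖ := by
  refine hqα.lt_of_ne fun heq => hq ?_
  refine v.isPrime.mem_of_pow_mem 2 ?_
  rw [hv, Ideal.mem_span_singleton, ← Nat.cast_pow]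
  exact dvd_natCast_of_norm_sq_embedding_eq σ (by rw [← heq, Nat.cast_pow])

variable [NumberField K]

theorem finite_of_isIntegral_mul_of_isBounded {S : Set K} {d : K} (hd : d ≠ 0)
    (hint : ∀ x ∈ S, IsIntegral ℤ (d * x))
    (hbdd : ∀ σ : K →+* ℂ, Bornology.IsBounded (σ '' S)) : S.Finite := by
  choose B hB using fun σ => (hbdd σ).exists_norm_le
  obtain ⟨C, hC⟩ := (Set.finite_range fun σ : K →+* ℂ => ‖σ d‖ * B σ).bddAbove
  refine Set.Finite.of_finite_image ?_ (mul_right_injective₀ hd).injOn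
  refine (NumberField.Embeddings.finite_of_norm_le K ℂ C).subset ?_
  rintro _ ⟨x, hx, rfl⟩
  refine ⟨hint x hx, fun σ => ?_⟩
  calc ‖σ (d * x)‖ = ‖σ d‖ * ‖σ x‖ := by rw [map_mul, norm_mul]
    _ ≤ ‖σ d‖ * B σ := by gcongr; exact hB σ _ ⟨x, hx, rfl⟩
    _ ≤ C := hC ⟨σ, rfl⟩

theorem IsDigitOrbit.finite_range {v : HeightOneSpectrum (𝓞 K)} {α q : 𝓞 K} {a : ℕ → 𝓞 K}
    {e : ℕ → ℕ} {t : ℕ → K} (h : IsDigitOrbit (α : K) (q : K) (algebraMap (𝓞 K) K ∘ a) e t)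
    (hv : v.asIdeal = Ideal.span {α}) (ha : (Set.range a).Finite)
    (ht : ∀ n, v.valuation K (t n) ≤ 1)
    (hσ : ∀ σ : K →+* ℂ, 1 ≤ ‖σ (α : K)‖ ∧ ‖σ (q : K)‖ < ‖σ (α : K)‖) : (Set.range t).Finite := by
  obtain ⟨d, hd, hrange⟩ := h.exists_mul_mem_range hv ht
  refine finite_of_isIntegral_mul_of_isBounded (d := (d : K)) (by simpa using hd) ?_ fun σ => ?_
  · rintro _ ⟨n, rfl⟩
    obtain ⟨y, hy⟩ := hrange n
    exact hy ▸ NumberField.RingOfIntegers.isIntegral_coe y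
  · rw [← Set.range_comp]
    refine (h.map σ).isBounded_range (hσ σ).1 (hσ σ).2 ?_
    rw [← Function.comp_assoc, Set.range_comp]
    exact (ha.image _).isBounded

end NumberField

section Tails

/-- The tail `s - ∑_{n < N} aₙ x ^ φ(n) yⁿ` of a series with sum `s`, divided by
`x ^ φ(N) y ^ N` so that consecutive tails satisfy the recursion `IsDigitOrbit` with `q = y⁻¹`. -/
noncomputable def normalizedTail {F : Type*} [Field F] (x y : F) (a : ℕ → F) (φ : ℕ → ℕ) (s : F)
    (N : ℕ) : F :=
  (s - ∑ n ∈ Finset.range N, a n * x ^ φ n * y ^ n) / (x ^ φ N * y ^ N)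

variable {F : Type*} [Field F] {x y : F} {a : ℕ → F} {φ : ℕ → ℕ} {s : F}

theorem isDigitOrbit_normalizedTail (hx : x ≠ 0) (hy : y ≠ 0) (hφ : StrictMono φ) :
    IsDigitOrbit x y⁻¹ a (fun n => φ (n + 1) - φ n) (normalizedTail x y a φ s) where
  exponent_ne_zero n := (Nat.sub_pos_of_lt (hφ n.lt_succ_self)).ne'
  step n := by
    have hpow : x ^ φ (n + 1) = x ^ (φ (n + 1) - φ n) * x ^ φ n :=
      (pow_sub_mul_pow x (hφ n.lt_succ_self).le).symm
    have hgap := pow_ne_zero (φ (n + 1) - φ n) hx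
    have hφn := pow_ne_zero (φ n) hx
    rw [normalizedTail, normalizedTail, Finset.sum_range_succ, hpow]
    field_simp
    ring

theorem hasSum_normalizedTail {A : Type*} [Ring A] [Algebra F A] [TopologicalSpace A]
    [IsTopologicalRing A] (hx : x ≠ 0) (hy : y ≠ 0) (hφ : Monotone φ)
    (hs : HasSum (fun n => algebraMap F A (a n * x ^ φ n * y ^ n)) (algebraMap F A s)) (N : ℕ) :
    HasSum (fun k => algebraMap F A (a (k + N) * x ^ (φ (k + N) - φ N) * y ^ k))
      (algebraMap F A (normalizedTail x y a φ s N)) := by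
  rw [← hasSum_nat_add_iff' N, ← map_sum, ← map_sub] at hs
  convert! hs.mul_left (algebraMap F A (x ^ φ N * y ^ N)⁻¹) using 1
  · ext k
    rw [← map_mul, ← pow_sub_mul_pow x (hφ (Nat.le_add_left N k)), pow_add]
    congr 1
    field_simp
  · rw [← map_mul, normalizedTail, div_eq_inv_mul]

variable {R K : Type*} [CommRing R] [IsDedekindDomain R] [Field K] [Algebra R K]
  [IsFractionRing R K] {v : HeightOneSpectrum R}

theorem valuation_normalizedTail_le_one {x y : K} {a : ℕ → K} {φ : ℕ → ℕ} {s : K} (hx0 : x ≠ 0)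
    (hy0 : y ≠ 0) (hx : v.valuation K x ≤ 1) (hy : v.valuation K y ≤ 1)
    (ha : ∀ n, v.valuation K (a n) ≤ 1) (hφ : Monotone φ)
    (hs : HasSum (fun n => algebraMap K (v.adicCompletion K) (a n * x ^ φ n * y ^ n))
      (algebraMap K (v.adicCompletion K) s)) (N : ℕ) :
    v.valuation K (normalizedTail x y a φ s N) ≤ 1 := by
  rw [← valued_algebraMap]
  refine valued_le_one_of_hasSum (hasSum_normalizedTail hx0 hy0 hφ hs N) fun k => ?_
  rw [valued_algebraMap, map_mul, map_mul, map_pow, map_pow]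
  exact mul_le_one' (mul_le_one' (ha _) (pow_le_one' hx _)) (pow_le_one' hy _)

end Tails

section Series

theorem coeff_gSeries {K : Type*} [Field K] (x : K) (ψ : ℕ → ℕ∞) (a : ℕ → ℕ) (n : ℕ) :
    PowerSeries.coeff n (gSeries x ψ a) = (a n : K) * powENat x (ψ n) :=
  PowerSeries.coeff_mk _ _

theorem powENat_natCast {K : Type*} [Field K] (x : K) (m : ℕ) : powENat x (m : ℕ∞) = x ^ m := by
  simp [powENat]

theorem IsAdmissible.natCast_le {ψ : ℕ → ℕ∞} (hψ : IsAdmissible ψ) (n : ℕ) : (n : ℕ∞) ≤ ψ n := by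
  have hlower : IsLowerSet {n | ψ n ≠ ⊤} := by
    rcases hψ.1 with ⟨N, hN⟩ | huniv
    · exact hN ▸ isLowerSet_Iic N
    · exact huniv ▸ isLowerSet_univ
  induction n with
  | zero => simp
  | succ n ih =>
    by_cases htop : ψ (n + 1) = ⊤
    · simp [htop]
    have hlt : ψ n < ψ (n + 1) := hψ.2 (hlower n.le_succ htop) htop n.lt_succ_self
    exact_mod_cast Order.add_one_le_of_lt (ih.trans_lt hlt)

theorem exists_strictMono_eq_natCast {ψ : ℕ → ℕ∞} (hmono : StrictMonoOn ψ {n | ψ n ≠ ⊤})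
    (huniv : {n | ψ n ≠ ⊤} = Set.univ) :
    ∃ φ : ℕ → ℕ, StrictMono φ ∧ ψ = fun n => (φ n : ℕ∞) := by
  choose φ hφ using fun n => ENat.ne_top_iff_exists.mp (Set.eq_univ_iff_forall.mp huniv n)
  obtain rfl : ψ = fun n => (φ n : ℕ∞) := funext fun n => (hφ n).symm
  rw [huniv, strictMonoOn_univ] at hmono
  exact ⟨φ, fun m n hmn => Nat.cast_lt.mp (hmono hmn), rfl⟩

theorem isRationalFunction_gSeries_of_eventually_top {K : Type*} [Field K] (x : K) {ψ : ℕ → ℕ∞}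
    (a : ℕ → ℕ) {N : ℕ} (hψ : ∀ n, N < n → ψ n = ⊤) : IsRationalFunction (gSeries x ψ a) := by
  refine isRationalFunction_of_coeff_mul_eq_zero (Q := 1) one_ne_zero (N := N + 1) fun n hn => ?_
  simp [coeff_gSeries, hψ n hn, powENat]

variable {K : Type*} [Field K] [NumberField K] {v : HeightOneSpectrum (𝓞 K)}

theorem IsAdmissible.valuation_powENat_le {ψ : ℕ → ℕ∞} (hψ : IsAdmissible ψ) {x : K}
    (hx : v.valuation K x ≤ 1) (n : ℕ) :
    v.valuation K (powENat x (ψ n)) ≤ v.valuation K x ^ n := by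
  have hle := hψ.natCast_le n
  induction hn : ψ n with
  | top => simp [powENat]
  | coe m =>
    rw [hn, Nat.cast_le] at hle
    rw [powENat_natCast, map_pow]
    exact pow_le_pow_right_of_le_one' hx hle

theorem exists_hasValueAt_gSeries {x y : K} (hx : v.valuation K x < 1)
    (hy : v.valuation K y ≤ 1) {ψ : ℕ → ℕ∞} (hψ : IsAdmissible ψ) (a : ℕ → ℕ) :
    ∃ s, HasValueAt v (gSeries x ψ a) y s := by
  have hpow : Filter.Tendsto (fun n : ℕ => algebraMap K (v.adicCompletion K) x ^ n)
      Filter.cofinite (nhds 0) := by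
    rw [Nat.cofinite_eq_atTop]
    exact Valued.tendsto_zero_pow_of_v_lt_one (by rwa [valued_algebraMap])
  refine summable_of_valued_le hpow fun n => ?_
  rw [map_pow, valued_algebraMap, valued_algebraMap, coeff_gSeries, map_mul, map_mul, map_pow]
  calc v.valuation K (a n) * v.valuation K (powENat x (ψ n)) * v.valuation K y ^ n
      ≤ 1 * v.valuation K x ^ n * 1 := by
        gcongr
        · exact valuation_natCast_le_one _
        · exact hψ.valuation_powENat_le hx.le n
        · exact pow_le_one' hy n
    _ = v.valuation K x ^ n := by rw [one_mul, mul_one]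

end Series

section Periodicity

theorem isRationalFunction_gSeries_of_gap_eq {K : Type*} [Field K] {x : K} (hx : x ≠ 0) {φ : ℕ → ℕ}
    (hφ : Monotone φ) {a : ℕ → ℕ} {m n : ℕ} (hmn : m ≠ n)
    (ha : ∀ k, a (m + k) = a (n + k))
    (hgap : ∀ k, φ (m + k + 1) - φ (m + k) = φ (n + k + 1) - φ (n + k)) :
    IsRationalFunction (gSeries x (fun k => (φ k : ℕ∞)) a) := by
  have hsucc : ∀ k, x ^ φ (k + 1) = x ^ (φ (k + 1) - φ k) * x ^ φ k := fun k =>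
    (pow_sub_mul_pow x (hφ k.le_succ)).symm
  have hpow : ∀ k, x ^ φ (n + k) = x ^ φ n / x ^ φ m * x ^ φ (m + k) := by
    intro k
    induction k with
    | zero => exact (div_mul_cancel₀ _ (pow_ne_zero _ hx)).symm
    | succ k ih => rw [← add_assoc, ← add_assoc, hsucc, hsucc (m + k), ih, hgap, mul_left_comm]
  refine isRationalFunction_of_coeff_add_eq_mul hmn (x ^ φ n / x ^ φ m) fun k => ?_
  rw [coeff_gSeries, coeff_gSeries, powENat_natCast, powENat_natCast, hpow, ha, mul_left_comm]

theorem finite_range_of_sub_mem {R : Type*} [CommRing R] {I : Ideal R} [Finite (R ⧸ I)] {ι : Type*}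
    {a : ι → R} (hinj : ∀ m n, a m - a n ∈ I → a m = a n) : (Set.range a).Finite := by
  refine Set.Finite.of_finite_image (f := Ideal.Quotient.mk I) (Set.toFinite _) ?_
  rintro _ ⟨m, rfl⟩ _ ⟨n, rfl⟩ h
  exact hinj m n (Ideal.Quotient.eq.mp h)

variable {K : Type*} [Field K] [NumberField K] {v : HeightOneSpectrum (𝓞 K)} {α : 𝓞 K}

theorem IsDigitOrbit.exists_shift_eq {q : 𝓞 K} {a : ℕ → 𝓞 K} {e : ℕ → ℕ} {t : ℕ → K}
    (h : IsDigitOrbit (α : K) (q : K) (algebraMap (𝓞 K) K ∘ a) e t)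
    (hv : v.asIdeal = Ideal.span {α}) (hq : q ∉ v.asIdeal) (ha : ∀ n, a n ∉ v.asIdeal)
    (hinj : ∀ m n, a m - a n ∈ v.asIdeal → a m = a n) (ht : ∀ n, v.valuation K (t n) ≤ 1)
    (hσ : ∀ σ : K →+* ℂ, 1 ≤ ‖σ (α : K)‖ ∧ ‖σ (q : K)‖ < ‖σ (α : K)‖) :
    ∃ m n, m ≠ n ∧ ∀ k, a (m + k) = a (n + k) ∧ e (m + k) = e (n + k) := by
  have hα0 := algebraMap_generator_ne_zero (K := K) hv
  have hvα := valuation_generator_lt_one (K := K) hv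
  have hvq : v.valuation K (q : K) = 1 := v.valuation_eq_one_iff_notMem.mpr hq
  have hva : ∀ n, v.valuation K (a n : K) = 1 := fun n => v.valuation_eq_one_iff_notMem.mpr (ha n)
  have hvinj : ∀ m n, v.valuation K ((a m : K) - a n) < 1 → (a m : K) = a n := by
    intro m n hmn
    rw [← map_sub, v.valuation_lt_one_iff_mem] at hmn
    rw [hinj m n hmn]
  have hfin : (Set.range a).Finite := finite_range_of_sub_mem hinj
  obtain ⟨m, -, n, -, hmn, hmn'⟩ := Set.infinite_univ.exists_ne_map_eq_of_mapsTo
    (fun n _ => Set.mem_range_self n) (h.finite_range hv hfin ht hσ)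
  refine ⟨m, n, hmn, fun k => ?_⟩
  have htk := h.add_eq hα0 hvα hvq hva ht hvinj hmn' k
  have hdigit := h.digit_eq hvα hvq ht hvinj htk
  exact ⟨NumberField.RingOfIntegers.ext hdigit, h.exponent_eq hα0 hvα hvq hva ht htk hdigit⟩

theorem isRationalFunction_gSeries_of_hasValueAt (hv : v.asIdeal = Ideal.span {α}) {q : ℕ}
    (hq : (q : 𝓞 K) ∉ v.asIdeal) (hqα : ∀ σ : K →+* ℂ, q ≤ ‖σ (α : K)‖) {a : ℕ → ℕ}
    (ha : ∀ n, (a n : 𝓞 K) ∉ v.asIdeal)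
    (hinj : ∀ m n, (a m : 𝓞 K) - a n ∈ v.asIdeal → a m = a n) {φ : ℕ → ℕ} (hφ : StrictMono φ)
    {s : K} (hs : HasValueAt v (gSeries (α : K) (fun n => (φ n : ℕ∞)) a) (1 / (q : K))
      (algebraMap K (v.adicCompletion K) s)) :
    IsRationalFunction (gSeries (α : K) (fun n => (φ n : ℕ∞)) a) := by
  have hα0 := algebraMap_generator_ne_zero (K := K) hv
  have hq0 : q ≠ 0 := by
    rintro rfl
    simp at hq
  have hqK : (1 / (q : K)) ≠ 0 := by simpa using hq0
  simp only [HasValueAt, coeff_gSeries, powENat_natCast] at hs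
  have ht := valuation_normalizedTail_le_one hα0 hqK (v.valuation_le_one α)
    (by simp [valuation_natCast_eq_one_iff.mpr hq])
    (fun n => valuation_natCast_le_one _) hφ.monotone hs
  have horbit : IsDigitOrbit (α : K) ((q : 𝓞 K) : K) (algebraMap (𝓞 K) K ∘ fun n => (a n : 𝓞 K))
      (fun n => φ (n + 1) - φ n)
      (normalizedTail (α : K) (1 / (q : K)) (fun n => (a n : K)) φ s) := by
    simpa [Function.comp_def] using isDigitOrbit_normalizedTail hα0 hqK hφ
  have hσ : ∀ σ : K →+* ℂ, 1 ≤ ‖σ (α : K)‖ ∧ ‖σ ((q : 𝓞 K) : K)‖ < ‖σ (α : K)‖ := fun σ =>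
    ⟨(Nat.one_le_cast.mpr (Nat.one_le_iff_ne_zero.mpr hq0)).trans (hqα σ), by
      simpa using natCast_lt_norm_embedding hv hq (hqα σ)⟩
  obtain ⟨m, n, hmn, hshift⟩ := horbit.exists_shift_eq hv hq ha
    (fun m n h => congrArg Nat.cast (hinj m n h)) ht hσ
  exact isRationalFunction_gSeries_of_gap_eq hα0 hφ.monotone hmn
    (fun k => Nat.cast_injective (hshift k).1) fun k => (hshift k).2

end Periodicity

section PrimeNorm

theorem eq_of_natCast_sub_mem {R : Type*} [CommRing R] [IsDedekindDomain R] [Module.Free ℤ R]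
    {I : Ideal R} (hI : (Ideal.absNorm I).Prime) {m n : ℕ} (hm : m < Ideal.absNorm I)
    (hn : n < Ideal.absNorm I) (h : (m : R) - n ∈ I) : m = n := by
  have hdvd : (Ideal.absNorm I : ℤ) ∣ (m : ℤ) - n := by
    rw [← Ideal.mem_span_singleton, Ideal.span_singleton_absNorm hI, Ideal.mem_comap]
    simpa using h
  exact ((Nat.modEq_iff_dvd.mpr hdvd).eq_of_lt_of_lt hn hm).symm

theorem eq_of_natCast_sub_mem_place {K : Type*} [Field K] [NumberField K] {α : 𝓞 K}
    (hp : (Algebra.norm ℤ α).natAbs.Prime) {m n : ℕ} (hm : m < (Algebra.norm ℤ α).natAbs)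
    (hn : n < (Algebra.norm ℤ α).natAbs) (h : (m : 𝓞 K) - n ∈ (place α hp).asIdeal) : m = n := by
  rw [← Ideal.absNorm_span_singleton] at hp hm hn
  exact eq_of_natCast_sub_mem hp hm hn h

theorem natCast_notMem_place {K : Type*} [Field K] [NumberField K] {α : 𝓞 K}
    (hp : (Algebra.norm ℤ α).natAbs.Prime) {n : ℕ} (h0 : 0 < n)
    (hn : n < (Algebra.norm ℤ α).natAbs) : (n : 𝓞 K) ∉ (place α hp).asIdeal := fun hmem =>
  h0.ne' (eq_of_natCast_sub_mem_place hp hn hp.pos (by simpa using hmem))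

end PrimeNorm

end CollatzCNS

theorem mainTheorem9_general (K : Type*) [Field K] [NumberField K]
    (v : HeightOneSpectrum (𝓞 K)) (α : 𝓞 K) (hv : v.asIdeal = Ideal.span {α})
    (q : ℕ) (hq : (q : 𝓞 K) ∉ v.asIdeal)
    (hqα : ∀ σ : K →+* ℂ, (q : ℝ) ≤ ‖σ (α : K)‖)
    (ψ : ℕ → ℕ∞) (hψ : CollatzCNS.IsAdmissible ψ)
    (a : ℕ → ℕ) (ha : ∀ n, (a n : 𝓞 K) ∉ v.asIdeal)
    (hinj : ∀ m n, (a m : 𝓞 K) - a n ∈ v.asIdeal → a m = a n) :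
    ∃ s : v.adicCompletion K,
      CollatzCNS.HasValueAt v (CollatzCNS.gSeries (α : K) ψ a) (1 / (q : K)) s ∧
      (CollatzCNS.IsRationalFunction (CollatzCNS.gSeries (α : K) ψ a) ↔
        s ∈ Set.range (algebraMap K (v.adicCompletion K))) := by
  have hvα := CollatzCNS.valuation_generator_lt_one (K := K) hv
  have hvq : v.valuation K (1 / (q : K)) ≤ 1 := by
    simp [CollatzCNS.valuation_natCast_eq_one_iff.mpr hq]
  obtain ⟨s, hs⟩ := CollatzCNS.exists_hasValueAt_gSeries hvα hvq hψ a
  refine ⟨s, hs, fun hrat => hrat.mem_range_of_hasSum hs, ?_⟩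
  rintro ⟨x, rfl⟩
  rcases hψ.1 with ⟨N, hN⟩ | huniv
  · refine CollatzCNS.isRationalFunction_gSeries_of_eventually_top _ a (N := N) fun n hn => ?_
    exact of_not_not fun hfin => hn.not_ge ((Set.ext_iff.mp hN n).mp hfin)
  · obtain ⟨φ, hφ, rfl⟩ := CollatzCNS.exists_strictMono_eq_natCast hψ.2 huniv
    exact CollatzCNS.isRationalFunction_gSeries_of_hasValueAt hv hq hqα ha hinj hφ hs

theorem mainTheorem9 (K : Type*) [Field K] [NumberField K]
    (hK : CollatzCNS.IsMonogenic K)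
    (α : 𝓞 K) (hα : CollatzCNS.IsCNS α)
    (hp : (Algebra.norm ℤ α).natAbs.Prime)
    (p : ℕ) (hpα : p = (Algebra.norm ℤ α).natAbs)
    (q : ℕ) (hq : 0 < q) (hqp : q < p)
    (hqα : ∀ σ : K →+* ℂ, (q : ℝ) ≤ ‖σ (α : K)‖)
    (ψ : ℕ → ℕ∞) (hψ : CollatzCNS.IsAdmissible ψ)
    (a : ℕ → ℕ) (ha : ∀ n, 1 ≤ a n ∧ a n ≤ p - 1) :
    ∃ s : (CollatzCNS.place α hp).adicCompletion K,
      CollatzCNS.HasValueAt (CollatzCNS.place α hp)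
        (CollatzCNS.gSeries (α : K) ψ a) (1 / (q : K)) s ∧
      (CollatzCNS.IsRationalFunction (CollatzCNS.gSeries (α : K) ψ a) ↔
        s ∈ Set.range (algebraMap K ((CollatzCNS.place α hp).adicCompletion K))) := by
  subst hpα
  have ha' : ∀ n, a n < (Algebra.norm ℤ α).natAbs := fun n =>
    (ha n).2.trans_lt (Nat.sub_one_lt hp.ne_zero)
  exact mainTheorem9_general K _ α rfl q (CollatzCNS.natCast_notMem_place hp hq hqp) hqα ψ hψ a
    (fun n => CollatzCNS.natCast_notMem_place hp (ha n).1 (ha' n))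
    fun m n => CollatzCNS.eq_of_natCast_sub_mem_place hp (ha' m) (ha' n)
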